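/- For integers $N \ge 1$ and $j \ge 0$, let $B_{N,j}$ (respectively $C_{N,j}$) be the number of permutations $a_1a_2\cdots a_N$ of $\{1,2,\ldots,N\}$ that have exactly $j$ ascents (indices $i$ with $1 \le i \le N-1$ and $a_i < a_{i+1}$) and an even (respectively odd) number of inversions (pairs $i<j'$ with $a_i > a_{j'}$). Let $p$ be an odd prime, let $m$ be a positive integer, and let $n$ be a positive integer divisible by $p^m$. If $k$ is a positive integer divisible by $p$, then $B_{n-1,k-1}$ and $C_{n-1,k-1}$ are both divisible by $p^m$. -/

import Mathlib

/-- The number of ascents of a permutation `σ` of `Fin n`, written as the word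
`σ 0, σ 1, …, σ (n - 1)`: the number of pairs of adjacent positions `(i, i + 1)` with
`σ i < σ (i + 1)`. (The letters are `0, …, n - 1` instead of `1, …, n`.) -/
def ascentCount {n : ℕ} (σ : Equiv.Perm (Fin n)) : ℕ :=
  (Finset.univ.filter
    (fun q : Fin n × Fin n => (q.1 : ℕ) + 1 = (q.2 : ℕ) ∧ σ q.1 < σ q.2)).card

/-- The number of inversions of a permutation: pairs of positions `i < j` with `σ j < σ i`. -/
def inversionCount {n : ℕ} (σ : Equiv.Perm (Fin n)) : ℕ :=
  (Finset.univ.filter (fun q : Fin n × Fin n => q.1 < q.2 ∧ σ q.2 < σ q.1)).card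

/-- `B_{n,k}`: the number of permutations of `n` letters with exactly `k` ascents and an even
number of inversions. -/
def evenEulerian (n k : ℕ) : ℕ :=
  (Finset.univ.filter
    (fun σ : Equiv.Perm (Fin n) => ascentCount σ = k ∧ Even (inversionCount σ))).card

/-- `C_{n,k}`: the number of permutations of `n` letters with exactly `k` ascents and an odd
number of inversions. -/
def oddEulerian (n k : ℕ) : ℕ :=
  (Finset.univ.filter
    (fun σ : Equiv.Perm (Fin n) => ascentCount σ = k ∧ Odd (inversionCount σ))).card

/-! Stable sorting maps words in `Fin N → Fin x` to permutations, preserves inversions, and has `(x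
+ ascentCount τ).choose N` words over `τ`. So weighting words by 1 or by sign gives Worpitzky
identities for B + C and B - C, with totals `x ^ N` and `x ^ ((N + 1) / 2)`. Inverting, with N = n -
1, each of B ± C is a sum of terms ± `n.choose i` * (n - k - i)^e. If p ∤ i, the binomial is
divisible by p^m; if p ∣ i, the base is divisible by p and e ≥ m. As p is odd, B and C follow from B
± C. -/

/-- The number of inversions of a word: pairs of positions `i < j` with `w j < w i`. -/
def wordInversionCount {α : Type*} [LinearOrder α] {N : ℕ} (w : Fin N → α) : ℕ :=
  (Finset.univ.filter (fun q : Fin N × Fin N => q.1 < q.2 ∧ w q.2 < w q.1)).card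

/-- The number of ascents of `σ` among the positions up to `i`. -/
def prefixAscentCount {N : ℕ} (σ : Equiv.Perm (Fin N)) (i : Fin N) : ℕ :=
  (Finset.univ.filter
    (fun q : Fin N × Fin N => ((q.1 : ℕ) + 1 = (q.2 : ℕ) ∧ σ q.1 < σ q.2) ∧ q.2 ≤ i)).card

/-- A pair of positions inverted by `τ` is carried to its pair of values, swapped. Stability keeps
ties in order, so equal letters yield no inversion. -/
theorem inversionCount_sort {α : Type*} [LinearOrder α] {N : ℕ} (w : Fin N → α) :
    inversionCount (Tuple.sort w) = wordInversionCount w := by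
  obtain ⟨hmono, hstable⟩ := Tuple.eq_sort_iff.1 (rfl : Tuple.sort w = Tuple.sort w)
  set τ := Tuple.sort w
  unfold inversionCount wordInversionCount
  refine Finset.card_nbij' (fun q => (τ q.2, τ q.1)) (fun q => (τ.symm q.2, τ.symm q.1))
    ?_ ?_ (fun q _ => by simp) (fun q _ => by simp)
  · intro q hq
    simp only [Finset.coe_filter, Finset.mem_univ, true_and, Set.mem_ofPred_eq] at hq ⊢
    refine ⟨hq.2, lt_of_le_of_ne (hmono hq.1.le) fun h => ?_⟩
    exact lt_asymm hq.2 (hstable _ _ hq.1 h)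
  · intro q hq
    simp only [Finset.coe_filter, Finset.mem_univ, true_and, Set.mem_ofPred_eq,
      Equiv.apply_symm_apply] at hq ⊢
    refine ⟨lt_of_not_ge fun h => ?_, hq.1⟩
    have := hmono h
    simp only [Function.comp, Equiv.apply_symm_apply] at this
    exact absurd hq.2 this.not_gt

theorem prefixAscentCount_zero {n : ℕ} (σ : Equiv.Perm (Fin (n + 1))) :
    prefixAscentCount σ 0 = 0 := by
  unfold prefixAscentCount
  rw [Finset.card_eq_zero, Finset.filter_eq_empty_iff]
  rintro q - ⟨⟨h, -⟩, h0⟩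
  rw [Fin.le_zero_iff] at h0
  simp [h0] at h

theorem prefixAscentCount_last {n : ℕ} (σ : Equiv.Perm (Fin (n + 1))) :
    prefixAscentCount σ (Fin.last n) = ascentCount σ := by
  simp [prefixAscentCount, ascentCount, Fin.le_last]

theorem prefixAscentCount_succ {n : ℕ} (σ : Equiv.Perm (Fin (n + 1))) (i : Fin n) :
    prefixAscentCount σ i.succ =
      prefixAscentCount σ i.castSucc + if σ i.castSucc < σ i.succ then 1 else 0 := by
  unfold prefixAscentCount
  have hdisj : Disjoint
      (Finset.univ.filter (fun q : Fin (n + 1) × Fin (n + 1) =>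
        ((q.1 : ℕ) + 1 = (q.2 : ℕ) ∧ σ q.1 < σ q.2) ∧ q.2 ≤ i.castSucc))
      (if σ i.castSucc < σ i.succ then {(i.castSucc, i.succ)} else ∅) := by
    split_ifs <;> simp
  have hcard : (if σ i.castSucc < σ i.succ then 1 else 0) =
      (if σ i.castSucc < σ i.succ then
        ({(i.castSucc, i.succ)} : Finset (Fin (n + 1) × Fin (n + 1))) else ∅).card := by
    split_ifs <;> simp
  rw [hcard, ← Finset.card_union_of_disjoint hdisj]
  congr 1
  ext ⟨a, b⟩
  have hab : ((a : ℕ) + 1 = b ∧ b ≤ i.succ) ↔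
      ((a : ℕ) + 1 = b ∧ b ≤ i.castSucc) ∨ (a = i.castSucc ∧ b = i.succ) := by
    simp only [Fin.le_def, Fin.ext_iff, Fin.val_succ, Fin.val_castSucc]
    omega
  have hmem : (a, b) ∈ (if σ i.castSucc < σ i.succ then
        ({(i.castSucc, i.succ)} : Finset (Fin (n + 1) × Fin (n + 1))) else ∅) ↔
      (a = i.castSucc ∧ b = i.succ) ∧ σ a < σ b := by
    split_ifs with h
    · simp only [Finset.mem_singleton, Prod.mk.injEq]
      exact ⟨fun h' => ⟨h', by rwa [h'.1, h'.2]⟩, And.left⟩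
    · simp only [Finset.notMem_empty, false_iff]
      rintro ⟨⟨rfl, rfl⟩, h'⟩
      exact h h'
  rw [Finset.mem_union, hmem]
  simp only [Finset.mem_filter, Finset.mem_univ, true_and]
  tauto

/-- Along a stable sort, equality of consecutive letters is allowed only at ascents of `τ`; adding 1
at each ascent makes every step strict. -/
theorem sort_eq_iff_strictMono {n x : ℕ} (w : Fin (n + 1) → Fin x)
    (τ : Equiv.Perm (Fin (n + 1))) :
    Tuple.sort w = τ ↔ StrictMono fun i => (w (τ i) : ℕ) + prefixAscentCount τ i := by
  rw [eq_comm, Tuple.eq_sort_iff', Fin.strictMono_iff_lt_succ, Fin.strictMono_iff_lt_succ]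
  refine forall_congr' fun i => ?_
  rw [prefixAscentCount_succ]
  have : (τ.trans (Tuple.graphEquiv₁ w) i.castSucc < τ.trans (Tuple.graphEquiv₁ w) i.succ) ↔
      toLex (w (τ i.castSucc), τ i.castSucc) < toLex (w (τ i.succ), τ i.succ) := Iff.rfl
  rw [this, Prod.Lex.toLex_lt_toLex]
  simp only [Fin.lt_def, Fin.ext_iff]
  split_ifs <;> omega

theorem card_strictMono_fin (N M : ℕ) :
    (Finset.univ.filter (fun c : Fin N → Fin M => StrictMono c)).card = M.choose N := by
  classical
  rw [← Finset.card_fin M, ← Finset.card_powersetCard, Finset.card_fin M]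
  refine Finset.card_bij (fun c _ => Finset.univ.image c) ?_ ?_ ?_
  · intro c hc
    rw [Finset.mem_powersetCard]
    exact ⟨Finset.subset_univ _, by
      rw [Finset.card_image_of_injective _ (Finset.mem_filter.1 hc).2.injective, Finset.card_fin]⟩
  · intro c hc d hd h
    rw [← (Finset.mem_filter.1 hc).2.range_inj (Finset.mem_filter.1 hd).2]
    simpa [← Finset.coe_inj] using h
  · intro s hs
    have hs' := (Finset.mem_powersetCard.1 hs).2
    refine ⟨s.orderEmbOfFin hs', by simp [OrderEmbedding.strictMono], ?_⟩
    simp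

theorem card_sort_eq (N x : ℕ) (τ : Equiv.Perm (Fin N)) :
    (Finset.univ.filter (fun w : Fin N → Fin x => Tuple.sort w = τ)).card =
      (x + ascentCount τ).choose N := by
  obtain _ | n := N
  · rw [Finset.filter_true_of_mem fun _ _ => Subsingleton.elim _ _]
    simp
  rw [← card_strictMono_fin]
  have hle : ∀ i, prefixAscentCount τ i ≤ ascentCount τ := fun i =>
    Finset.card_le_card fun q hq => by
      simp only [Finset.mem_filter] at hq ⊢
      exact ⟨hq.1, hq.2.1⟩
  have hstep : ∀ i : Fin n,
      prefixAscentCount τ i.succ ≤ prefixAscentCount τ i.castSucc + 1 := fun i => by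
    rw [prefixAscentCount_succ]
    split_ifs <;> omega
  refine Finset.card_bij
    (fun w _ i => ⟨w (τ i) + prefixAscentCount τ i, by have := hle i; omega⟩) ?_ ?_ ?_
  · intro w hw
    simp only [Finset.mem_filter, Finset.mem_univ, true_and, sort_eq_iff_strictMono] at hw ⊢
    exact fun i j hij => hw hij
  · intro w _ w' _ h
    ext j
    have := congrFun h (τ.symm j)
    simpa using this
  · intro c hc
    replace hc : StrictMono c := (Finset.mem_filter.1 hc).2
    have hlow : ∀ i, prefixAscentCount τ i ≤ c i := by
      intro i
      induction i using Fin.induction with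
      | zero => simp [prefixAscentCount_zero]
      | succ i ih =>
        have h1 : (c i.castSucc : ℕ) < c i.succ := hc i.castSucc_lt_succ
        have := hstep i
        omega
    have hhigh : ∀ i, (c i : ℕ) < x + prefixAscentCount τ i := by
      intro i
      induction i using Fin.reverseInduction with
      | last => rw [prefixAscentCount_last]; exact (c _).2
      | cast i ih =>
        have h1 : (c i.castSucc : ℕ) < c i.succ := hc i.castSucc_lt_succ
        have := hstep i
        omega
    refine ⟨fun j => ⟨c (τ.symm j) - prefixAscentCount τ (τ.symm j), ?_⟩, ?_, ?_⟩
    · have := hlow (τ.symm j)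
      have := hhigh (τ.symm j)
      omega
    · simp only [Finset.mem_filter, Finset.mem_univ, true_and, sort_eq_iff_strictMono,
        Equiv.symm_apply_apply, Nat.sub_add_cancel (hlow _)]
      exact hc
    · ext i
      simp [Nat.sub_add_cancel (hlow _)]

theorem sum_inversionCount_mul_choose (g : ℕ → ℤ) (N x : ℕ) :
    ∑ τ : Equiv.Perm (Fin N), g (inversionCount τ) * ((x + ascentCount τ).choose N : ℤ) =
      ∑ w : Fin N → Fin x, g (wordInversionCount w) := by
  rw [← Finset.sum_fiberwise Finset.univ (fun w : Fin N → Fin x => Tuple.sort w)]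
  refine Finset.sum_congr rfl fun τ _ => ?_
  rw [Finset.sum_congr rfl (g := fun _ => g (inversionCount τ)) fun w hw => by
    rw [← inversionCount_sort, (Finset.mem_filter.1 hw).2]]
  rw [Finset.sum_const, card_sort_eq, nsmul_eq_mul, mul_comm]

/-! ### Signed count of words. -/

theorem wordInversionCount_cons {α : Type*} [LinearOrder α] {N : ℕ} (a : α) (w : Fin N → α) :
    wordInversionCount (Fin.cons a w : Fin (N + 1) → α) =
      (Finset.univ.filter fun i => w i < a).card + wordInversionCount w := by
  unfold wordInversionCount
  simp only [Finset.card_filter, Fintype.sum_prod_type, Fin.sum_univ_succ]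
  simp [Fin.succ_pos]

/-- Swapping distinct leading letters flips the sign; equal ones contribute evenly many inversions
with `v`. -/
theorem sign_wordInversionCount_cons_cons {α : Type*} [LinearOrder α] {N : ℕ} (a b : α)
    (v : Fin N → α) :
    (-1 : ℤ) ^ wordInversionCount (Fin.cons a (Fin.cons b v : Fin (N + 1) → α) : Fin (N + 2) → α) +
      (-1) ^ wordInversionCount (Fin.cons b (Fin.cons a v : Fin (N + 1) → α) : Fin (N + 2) → α) =
      if a = b then 2 * (-1) ^ wordInversionCount v else 0 := by
  have hcard : ∀ c d : α,
      (Finset.univ.filter fun i => (Fin.cons c v : Fin (N + 1) → α) i < d).card =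
        (if c < d then 1 else 0) + (Finset.univ.filter fun i => v i < d).card := fun c d => by
    simp only [Finset.card_filter, Fin.sum_univ_succ, Fin.cons_zero, Fin.cons_succ]
  simp only [wordInversionCount_cons, hcard, pow_add]
  rcases lt_trichotomy a b with h | rfl | h
  · simp only [h, h.not_gt, h.ne, if_true, if_false]
    ring
  · rcases neg_one_pow_eq_or ℤ (Finset.univ.filter fun i => v i < a).card with h | h <;>
      simp [h] <;> ring
  · simp only [h, h.not_gt, h.ne', if_true, if_false]
    ring

theorem sum_sign_wordInversionCount_add_two (N x : ℕ) :
    ∑ w : Fin (N + 2) → Fin x, (-1 : ℤ) ^ wordInversionCount w =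
      x * ∑ w : Fin N → Fin x, (-1 : ℤ) ^ wordInversionCount w := by
  have hcons : ∀ (M : ℕ) (F : (Fin (M + 1) → Fin x) → ℤ),
      ∑ w, F w = ∑ a : Fin x, ∑ v : Fin M → Fin x, F (Fin.cons a v) := fun M F => by
    rw [← (Fin.consEquiv fun _ => Fin x).sum_comp, Fintype.sum_prod_type]
    rfl
  set T : Fin x → Fin x → (Fin N → Fin x) → ℤ := fun a b v => (-1) ^ wordInversionCount
    (Fin.cons a (Fin.cons b v : Fin (N + 1) → Fin x) : Fin (N + 2) → Fin x) with hT
  have hsum : ∑ w : Fin (N + 2) → Fin x, (-1 : ℤ) ^ wordInversionCount w =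
      ∑ a, ∑ b, ∑ v, T a b v := by
    rw [hcons]
    exact Finset.sum_congr rfl fun a _ => hcons N _
  -- Doubling pairs (a, b) with (b, a), so only a = b survives.
  have htwo : ∑ a, ∑ b, ∑ v, T a b v + ∑ a, ∑ b, ∑ v, T a b v =
      2 * (x * ∑ w : Fin N → Fin x, (-1 : ℤ) ^ wordInversionCount w) := by
    nth_rewrite 2 [Finset.sum_comm]
    simp only [← Finset.sum_add_distrib, hT, sign_wordInversionCount_cons_cons]
    rw [Finset.sum_congr rfl fun a _ => Finset.sum_comm]
    simp [Finset.mul_sum, mul_left_comm]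
  rw [hsum]
  linarith

theorem sum_sign_wordInversionCount (N x : ℕ) :
    ∑ w : Fin N → Fin x, (-1 : ℤ) ^ wordInversionCount w = (x : ℤ) ^ ((N + 1) / 2) := by
  induction N using Nat.twoStepInduction with
  | zero => simp [wordInversionCount]
  | one =>
    have h : ∀ w : Fin 1 → Fin x, wordInversionCount w = 0 := fun w => by
      simp [wordInversionCount, Subsingleton.elim _ (0 : Fin 1)]
    simp [h]
  | more n ih _ =>
    rw [sum_sign_wordInversionCount_add_two, ih, ← pow_succ']
    congr 1
    omega

/-! ### Inversion by generating functions. -/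

theorem ascentCount_le {N : ℕ} (σ : Equiv.Perm (Fin N)) : ascentCount σ ≤ N := by
  conv_rhs => rw [← Finset.card_fin N]
  refine Finset.card_le_card_of_injOn Prod.fst (fun _ _ => Finset.mem_univ _) ?_
  rintro ⟨a, b⟩ h ⟨c, d⟩ h' hac
  simp only [Finset.coe_filter, Finset.mem_univ, true_and, Set.mem_ofPred_eq] at h h' hac
  subst hac
  simp only [Prod.mk.injEq, true_and, Fin.ext_iff]
  omega

open PowerSeries in
theorem mk_choose_mul_one_sub_pow {N a : ℕ} (ha : a ≤ N) :
    (mk fun x => ((x + a).choose N : ℤ)) * (1 - X) ^ (N + 1) = X ^ (N - a) := by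
  have hshift : (mk fun x => ((x + a).choose N : ℤ)) =
      X ^ (N - a) * mk fun x => ((N + x).choose N : ℤ) := by
    ext x
    rw [coeff_X_pow_mul', coeff_mk]
    split_ifs with h
    · rw [coeff_mk]
      congr 2
      omega
    · rw [Nat.choose_eq_zero_of_lt (by omega), Nat.cast_zero]
  rw [hshift, ← mk_one_pow_eq_mk_choose_add, mul_assoc, ← mul_pow, mk_one_mul_one_sub_eq_one,
    one_pow, mul_one]

open PowerSeries in
theorem coeff_one_sub_X_pow (n i : ℕ) :
    coeff i ((1 - X : ℤ⟦X⟧) ^ n) = (-1) ^ i * (n.choose i : ℤ) := by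
  have : (1 - X : ℤ⟦X⟧) ^ n = rescale (-1) (((1 + Polynomial.X : Polynomial ℤ) ^ n : _) : ℤ⟦X⟧) := by
    simp [rescale_X, sub_eq_add_neg]
  rw [this, coeff_rescale, Polynomial.coeff_coe, Polynomial.coeff_one_add_X_pow]

open PowerSeries in
/-- Worpitzky inversion: weights whose binomial transform is `x ↦ x ^ e` are alternating sums
of `e`-th powers. -/
theorem sum_filter_ascentCount_eq {N e a : ℕ} (g : ℕ → ℤ) (ha : a ≤ N)
    (hg : ∀ x : ℕ, ∑ w : Fin N → Fin x, g (wordInversionCount w) = (x : ℤ) ^ e) :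
    ∑ τ : Equiv.Perm (Fin N) with ascentCount τ = a, g (inversionCount τ) =
      ∑ q ∈ Finset.HasAntidiagonal.antidiagonal (N - a),
        (-1) ^ q.1 * ((N + 1).choose q.1 : ℤ) * (q.2 : ℤ) ^ e := by
  have hseries : ∑ τ : Equiv.Perm (Fin N), C (g (inversionCount τ)) *
      (mk fun x => ((x + ascentCount τ).choose N : ℤ)) = mk fun x => (x : ℤ) ^ e := by
    ext x
    simp only [map_sum, coeff_C_mul, coeff_mk]
    rw [sum_inversionCount_mul_choose, hg]
  have hcoeff := congrArg (fun f => coeff (N - a) ((1 - X) ^ (N + 1) * f)) hseries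
  simp only [coeff_mul (N - a) _ (mk _), coeff_one_sub_X_pow, coeff_mk] at hcoeff
  rw [← hcoeff, Finset.mul_sum, map_sum, Finset.sum_filter]
  refine Finset.sum_congr rfl fun τ _ => ?_
  rw [mul_left_comm, mul_comm ((1 - X) ^ _), mk_choose_mul_one_sub_pow (ascentCount_le τ),
    coeff_C_mul, coeff_X_pow, mul_ite, mul_one, mul_zero]
  -- Both counts are at most `N`, so truncated `N - ·` separates them.
  have := ascentCount_le τ
  congr 1
  exact propext (by omega)

/-! ### Divisibility. -/

theorem prime_pow_dvd_choose {p m n i : ℕ} (hp : p.Prime) (hn : p ^ m ∣ n) (hi : ¬p ∣ i) :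
    p ^ m ∣ n.choose i := by
  obtain _ | i := i
  · simp at hi
  obtain _ | n := n
  · simp
  refine (Nat.Coprime.pow_left m ((hp.coprime_iff_not_dvd).2 hi)).dvd_of_dvd_mul_right ?_
  rw [← Nat.add_one_mul_choose_eq]
  exact hn.mul_right _

theorem prime_pow_dvd_sum_filter_ascentCount {p m N e a : ℕ} (hp : p.Prime)
    (hN : p ^ m ∣ N + 1) (ha : p ∣ N - a) (haN : a ≤ N) (hme : m ≤ e) (g : ℕ → ℤ)
    (hg : ∀ x : ℕ, ∑ w : Fin N → Fin x, g (wordInversionCount w) = (x : ℤ) ^ e) :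
    ((p ^ m : ℕ) : ℤ) ∣
      ∑ τ : Equiv.Perm (Fin N) with ascentCount τ = a, g (inversionCount τ) := by
  rw [sum_filter_ascentCount_eq g haN hg]
  refine Finset.dvd_sum fun q hq => ?_
  rw [← Finset.HasAntidiagonal.mem_antidiagonal.1 hq] at ha
  by_cases hq1 : p ∣ q.1
  · refine Dvd.dvd.mul_left ?_ _
    have : p ^ m ∣ q.2 ^ e :=
      (pow_dvd_pow p hme).trans (pow_dvd_pow_of_dvd ((Nat.dvd_add_right hq1).1 ha) e)
    exact_mod_cast this
  · exact ((Int.natCast_dvd_natCast.2 (prime_pow_dvd_choose hp hN hq1)).mul_left _).mul_right _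

theorem cast_evenEulerian_add_oddEulerian (N a : ℕ) :
    (evenEulerian N a : ℤ) + oddEulerian N a =
      ∑ τ : Equiv.Perm (Fin N) with ascentCount τ = a, 1 := by
  simp only [evenEulerian, oddEulerian, Finset.card_filter, Finset.sum_filter, Nat.cast_sum,
    ← Finset.sum_add_distrib]
  refine Finset.sum_congr rfl fun τ _ => ?_
  by_cases h : Even (inversionCount τ)
  · simp [h]
  · simp [h, Nat.not_even_iff_odd.1 h]

theorem cast_evenEulerian_sub_oddEulerian (N a : ℕ) :
    (evenEulerian N a : ℤ) - oddEulerian N a =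
      ∑ τ : Equiv.Perm (Fin N) with ascentCount τ = a, (-1) ^ inversionCount τ := by
  simp only [evenEulerian, oddEulerian, Finset.card_filter, Finset.sum_filter, Nat.cast_sum,
    ← Finset.sum_sub_distrib]
  refine Finset.sum_congr rfl fun τ _ => ?_
  by_cases h : Even (inversionCount τ)
  · simp [h]
  · rw [Nat.not_even_iff_odd] at h
    by_cases ha : ascentCount τ = a <;> simp [h, ha]

theorem two_mul_lt_three_pow (m : ℕ) : 2 * m < 3 ^ m := by
  induction m with
  | zero => simp
  | succ m ih =>
    have := Nat.one_le_pow m 3 (by norm_num)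
    rw [pow_succ]
    omega

theorem corollary5p3 (p m n k : ℕ) (hp : p.Prime) (hp_odd : Odd p) (hm : 0 < m)
    (hn : 0 < n) (hpn : p ^ m ∣ n) (hk : 0 < k) (hpk : p ∣ k) :
    p ^ m ∣ evenEulerian (n - 1) (k - 1) ∧ p ^ m ∣ oddEulerian (n - 1) (k - 1) := by
  obtain ⟨N, rfl⟩ : ∃ N, n = N + 1 := ⟨n - 1, by omega⟩
  obtain ⟨a, rfl⟩ : ∃ a, k = a + 1 := ⟨k - 1, by omega⟩
  simp only [Nat.add_sub_cancel]
  -- For `N < a` both counts vanish; otherwise `N - a` is a true difference.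
  obtain haN | haN := lt_or_ge N a
  · have hne : ∀ σ : Equiv.Perm (Fin N), ascentCount σ ≠ a := fun σ =>
      ((ascentCount_le σ).trans_lt haN).ne
    simp [evenEulerian, oddEulerian, hne]
  have hp3 : 3 ≤ p := by
    have := hp.two_le
    obtain ⟨r, rfl⟩ := hp_odd
    omega
  -- This gives m ≤ (N + 1) / 2, the smaller of the two exponents.
  have hmN : 2 * m < N + 1 :=
    (two_mul_lt_three_pow m).trans_le ((Nat.pow_le_pow_left hp3 m).trans (Nat.le_of_dvd hn hpn))
  have hpa : p ∣ N - a := by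
    have := Nat.dvd_sub ((dvd_pow_self p hm.ne').trans hpn) hpk
    rwa [Nat.add_sub_add_right] at this
  have hadd := prime_pow_dvd_sum_filter_ascentCount (e := N) hp hpn hpa haN (by omega)
    (fun _ => 1) (fun x => by simp)
  have hsub := prime_pow_dvd_sum_filter_ascentCount (e := (N + 1) / 2) hp hpn hpa haN (by omega)
    (fun i => (-1) ^ i) (sum_sign_wordInversionCount N)
  rw [← cast_evenEulerian_add_oddEulerian] at hadd
  rw [← cast_evenEulerian_sub_oddEulerian] at hsub
  have hcop : (p ^ m).Coprime 2 := Nat.Coprime.pow_left m (Nat.coprime_two_right.2 hp_odd)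
  refine ⟨hcop.dvd_of_dvd_mul_left ?_, hcop.dvd_of_dvd_mul_left ?_⟩ <;>
    rw [← Int.natCast_dvd_natCast]
  · have := dvd_add hadd hsub
    rw [add_add_sub_cancel, ← two_mul] at this
    exact_mod_cast this
  · have := dvd_sub hadd hsub
    rw [show ∀ b c : ℤ, b + c - (b - c) = c + c by intros; ring, ← two_mul] at this
    exact_mod_cast this
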